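/- Let $(\Omega,\mathcal F)$ be a measurable space and let $\mathcal X$ be the set of bounded measurable functions $X:\Omega\to\mathbb R$. A \emph{capacity} is a function $w:\mathcal F\to\mathbb R$ with $w(\varnothing)=0$, $w(\Omega)=1$ and $w(A)\le w(B)$ whenever $A\subseteq B$; it is \emph{submodular} if $w(A\cup B)+w(A\cap B)\le w(A)+w(B)$ for all $A,B\in\mathcal F$. Let $\mathcal S$ be the set of submodular capacities. For a capacity $w$ and $X\in\mathcal X$, the Choquet integral is $$I_w(X)=\int_{-\infty}^0\bigl(w(X\ge x)-1\bigr)\,dx+\int_0^\infty w(X\ge x)\,dx .$$ For $t\in[0,1)$ put $\mathrm{VaR}^w_t(X)=\inf\{x\in\mathbb R: w(X\ge x)\le t\}$, and for $\alpha\in(0,1]$ define the Choquet Expected Shortfall $$\mathrm{ES}^w_\alpha(X)=\frac1\alpha\int_0^\alpha \mathrm{VaR}^w_t(X)\,dt .$$ The inf-convolution of $\rho_1,\dots,\rho_n:\mathcal X\to\mathbb R$ is $$\mathop{\square}_{i=1}^n\rho_i(X)=\inf\Bigl\{\sum_{i=1}^n\rho_i(X_i): X_1,\dots,X_n\in\mathcal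 X,\ \sum_{i=1}^nX_i=X\Bigr\}\in[-\infty,\infty),\qquad X\in\mathcal X .$$ Let $n\ge1$ and $\alpha_1,\dots,\alpha_n\in(0,1]$. Then for all submodular capacities $w_1,\dots,w_n\in\mathcal S$ and all $X\in\mathcal X$, $$\mathop{\square}_{i=1}^n\mathrm{ES}^{w_i}_{\alpha_i}(X)=\sup\Bigl\{I_w(X): w\in\mathcal S,\ w(A)\le\min_{1\le i\le n}\frac{w_i(A)}{\alpha_i}\text{ for all }A\in\mathcal F\Bigr\},$$ where $\sup\varnothing=-\infty$. In particular, for every submodular capacity $w$ and all $X\in\mathcal X$, $$\mathop{\square}_{i=1}^n\mathrm{ES}^{w}_{\alpha_i}(X)=\mathrm{ES}^{w}_{\max\{\alpha_1,\dots,\alpha_n\}}(X).$$ -/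

import Mathlib

namespace ChoquetES

/-- The measurable sets of `Ω`, that is, the σ-algebra as a type. Mathlib equips it with its
Boolean algebra structure (`⊔` is union, `⊓` is intersection, `≤` is inclusion). -/
abbrev MSet (Ω : Type*) [MeasurableSpace Ω] : Type _ := {A : Set Ω // MeasurableSet A}

/-- A capacity: an increasing real-valued function on the σ-algebra with value `0` at the empty
set and value `1` at the whole space. -/
structure Capacity (Ω : Type*) [MeasurableSpace Ω] where
  toFun : MSet Ω → ℝ
  increasing : ∀ A B : MSet Ω, (A : Set Ω) ⊆ (B : Set Ω) → toFun A ≤ toFun B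
  empty : toFun ⟨∅, MeasurableSet.empty⟩ = 0
  whole : toFun ⟨Set.univ, MeasurableSet.univ⟩ = 1

instance (Ω : Type*) [MeasurableSpace Ω] : CoeFun (Capacity Ω) (fun _ => MSet Ω → ℝ) :=
  ⟨Capacity.toFun⟩

/-- Submodularity of a capacity. -/
def Capacity.IsSubmodular {Ω : Type*} [MeasurableSpace Ω] (w : Capacity Ω) : Prop :=
  ∀ A B : MSet Ω, w (A ⊔ B) + w (A ⊓ B) ≤ w A + w B

/-- The space of bounded random variables: bounded measurable real functions on `Ω`. -/
def BddRV (Ω : Type*) [MeasurableSpace Ω] : Submodule ℝ (Ω → ℝ) where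
  carrier := {X | Measurable X ∧ ∃ C : ℝ, ∀ ω, |X ω| ≤ C}
  zero_mem' := ⟨measurable_const, 0, fun ω => by simp⟩
  add_mem' := by
    rintro X Y ⟨hX, C, hC⟩ ⟨hY, D, hD⟩
    exact ⟨hX.add hY, C + D, fun ω => (abs_add_le _ _).trans (add_le_add (hC ω) (hD ω))⟩
  smul_mem' := by
    rintro c X ⟨hX, C, hC⟩
    refine ⟨hX.const_smul c, |c| * C, fun ω => ?_⟩
    rw [Pi.smul_apply, smul_eq_mul, abs_mul]
    exact mul_le_mul_of_nonneg_left (hC ω) (abs_nonneg c)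

/-- The event `{X ≥ x}`. -/
def eventGE {Ω : Type*} [MeasurableSpace Ω] (X : BddRV Ω) (x : ℝ) : MSet Ω :=
  ⟨{ω | x ≤ (X : Ω → ℝ) ω}, measurableSet_le measurable_const X.2.1⟩

/-- The Choquet integral
`I_w(X) = ∫_{-∞}^0 (w(X ≥ x) - 1) dx + ∫_0^∞ w(X ≥ x) dx`. Since `X` is bounded, both integrands
are bounded, monotone and vanish outside a bounded interval. -/
noncomputable def choquet {Ω : Type*} [MeasurableSpace Ω] (w : Capacity Ω) (X : BddRV Ω) : ℝ :=
  (∫ x in Set.Iic (0 : ℝ), (w (eventGE X x) - 1)) + ∫ x in Set.Ioi (0 : ℝ), w (eventGE X x)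

/-- The left Choquet quantile `Q^w_a(X) = inf {x : w(X ≥ x) ≤ 1 - a}`, for `a ∈ (0,1]`. -/
noncomputable def leftQuantile {Ω : Type*} [MeasurableSpace Ω] (w : Capacity Ω) (a : ℝ)
    (X : BddRV Ω) : ℝ :=
  sInf {x : ℝ | w (eventGE X x) ≤ 1 - a}

/-- `VaR^w_t = Q^w_{1-t}`, for `t ∈ [0,1)`. -/
noncomputable def VaR {Ω : Type*} [MeasurableSpace Ω] (w : Capacity Ω) (t : ℝ)
    (X : BddRV Ω) : ℝ :=
  leftQuantile w (1 - t) X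

/-- The Choquet Expected Shortfall `ES^w_α(X) = (1/α) ∫_0^α VaR^w_t(X) dt`, for `α ∈ (0,1]`.
The integrand is bounded and monotone in `t` on `[0,1)`; for `α = 1` the endpoint `t = 1` is a
null set. -/
noncomputable def ES {Ω : Type*} [MeasurableSpace Ω] (w : Capacity Ω) (α : ℝ)
    (X : BddRV Ω) : ℝ :=
  (1 / α) * ∫ t in (0 : ℝ)..α, VaR w t X

/-- The allocations of `X` among `n` agents. -/
def allocations {Ω : Type*} [MeasurableSpace Ω] (n : ℕ) (X : BddRV Ω) :
    Set (Fin n → BddRV Ω) :=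
  {Y | ∑ i, Y i = X}

/-- The inf-convolution of `ρ_1, …, ρ_n`, as an infimum in the extended reals. -/
noncomputable def infConvolution {Ω : Type*} [MeasurableSpace Ω] {n : ℕ}
    (ρ : Fin n → BddRV Ω → ℝ) (X : BddRV Ω) : EReal :=
  ⨅ Y ∈ allocations n X, ((∑ i, ρ i (Y i) : ℝ) : EReal)

end ChoquetES

/-!
Bounding `X` between constants turns the Choquet integral into an integral over a bounded interval,
and Fubini turns the average of the quantiles over `(0, α)` into the Choquet integral of the
truncated capacity `min (w / α) 1`, which is again submodular.

The Choquet integral of a submodular capacity `w` is sublinear. Submodularity at the two events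
`{X ≥ x}` and `A ∩ {X ≥ x - h}`, whose union is `{X + h 1_A ≥ x}`, integrates to
`I_w(X + h 1_A) ≤ I_w(X) + h w(A)`, and a bounded `Y` lies below a constant plus a sum of such steps
over its upper level events, whose total cost is a Riemann sum of `x ↦ w(Y ≥ x)`.

If `m` is a real lower bound of the inf-convolution of sublinear functionals at `X`, the
Hahn–Banach theorem yields a linear functional dominated by all of them and at least `m` at `X`. On
indicators, this functional is an additive capacity below all the given ones, and the same staircase
argument shows that its Choquet integral dominates the functional. Conversely, subadditivity bounds
every allocation from below. When all the capacities are equal, the truncation at the largest `α`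
is the least of the truncations, so giving everything to that agent is optimal.
-/

namespace ChoquetES

open MeasureTheory Set

/-! ### Integrals over the real line -/

theorem setIntegral_Iic_eq_intervalIntegral {E : Type*} [NormedAddCommGroup E] [NormedSpace ℝ E]
    {f : ℝ → E} {a : ℝ} (hf : ∀ x ≤ a, f x = 0) (c : ℝ) :
    ∫ x in Iic c, f x = ∫ x in a..c, f x := by
  rcases le_total a c with hac | hca
  · rw [intervalIntegral.integral_of_le hac]
    exact setIntegral_eq_of_subset_of_forall_sdiff_eq_zero measurableSet_Iic Ioc_subset_Iic_self
      fun x hx => hf x (not_lt.1 fun hax => hx.2 ⟨hax, hx.1⟩)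
  · rw [intervalIntegral.integral_of_ge hca,
      setIntegral_eq_zero_of_forall_eq_zero fun x (hx : x ∈ Iic c) => hf x (hx.trans hca),
      setIntegral_eq_zero_of_forall_eq_zero fun x hx => hf x hx.2, neg_zero]

theorem setIntegral_Ioi_eq_intervalIntegral {E : Type*} [NormedAddCommGroup E] [NormedSpace ℝ E]
    {f : ℝ → E} {b : ℝ} (hf : ∀ x > b, f x = 0) (c : ℝ) :
    ∫ x in Ioi c, f x = ∫ x in c..b, f x := by
  rcases le_total c b with hcb | hbc
  · rw [intervalIntegral.integral_of_le hcb]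
    exact setIntegral_eq_of_subset_of_forall_sdiff_eq_zero measurableSet_Ioi Ioc_subset_Ioi_self
      fun x hx => hf x (not_le.1 fun hxb => hx.2 ⟨hx.1, hxb⟩)
  · rw [intervalIntegral.integral_of_ge hbc,
      setIntegral_eq_zero_of_forall_eq_zero fun x (hx : x ∈ Ioi c) => hf x (hbc.trans_lt hx),
      setIntegral_eq_zero_of_forall_eq_zero fun x hx => hf x hx.1, neg_zero]

theorem integral_comp_sub_right_le_integral_add {g : ℝ → ℝ} (hg : Antitone g)
    (hnonneg : ∀ x, 0 ≤ g x) {M : ℝ} (hM : ∀ x, g x ≤ M) {h : ℝ} (hh : 0 ≤ h) (a b : ℝ) :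
    ∫ x in a..b, g (x - h) ≤ (∫ x in a..b, g x) + h * M := by
  have hint (c d : ℝ) : IntervalIntegrable g volume c d := hg.intervalIntegrable
  have gained : ∫ x in (a - h)..a, g x ≤ h * M := by
    simpa using intervalIntegral.integral_mono_on (sub_le_self a hh) (hint _ _)
      (intervalIntegrable_const (c := M)) fun x _ => hM x
  have lost : 0 ≤ ∫ x in (b - h)..b, g x :=
    intervalIntegral.integral_nonneg (sub_le_self b hh) fun x _ => hnonneg x
  have split_left := intervalIntegral.integral_add_adjacent_intervals (hint (a - h) a) (hint a b)
  have split_right :=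
    intervalIntegral.integral_add_adjacent_intervals (hint (a - h) (b - h)) (hint (b - h) b)
  rw [intervalIntegral.integral_comp_sub_right g h]
  linarith

theorem sum_mul_le_integral_of_antitone {g : ℝ → ℝ} (hg : Antitone g) (a : ℝ) {h : ℝ}
    (hh : 0 ≤ h) (N : ℕ) :
    ∑ k ∈ Finset.range N, h * g (a + h * (k + 1 : ℕ)) ≤ ∫ x in a..a + h * N, g x := by
  have hsum := AntitoneOn.sum_le_integral (x₀ := 0) (a := N) (f := fun x => g (a + h * x))
    fun x _ y _ hxy => hg (by gcongr)
  have hscale := intervalIntegral.mul_integral_comp_add_mul (a := 0) (b := N) (f := g) h a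
  simp only [zero_add] at hsum
  rw [mul_zero, add_zero] at hscale
  rw [← Finset.mul_sum, ← hscale]
  exact mul_le_mul_of_nonneg_left hsum hh

theorem integral_ite_eq_sub {p : ℝ → Prop} [DecidablePred p] {a b c : ℝ} (hac : a ≤ c)
    (hcb : c ≤ b) (hp : ∀ x, a < x → x < c → p x) (hnp : ∀ x, c < x → x < b → ¬ p x) :
    ∫ x in a..b, (if p x then (1 : ℝ) else 0) = c - a := by
  have hae : ∀ᵐ x, x ∈ uIoc a b →
      (if p x then (1 : ℝ) else 0) = {x | x ≤ c}.indicator (fun _ => 1) x := by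
    filter_upwards [volume.ae_ne c, volume.ae_ne b] with x hxc hxb hx
    rw [uIoc_of_le (hac.trans hcb)] at hx
    rcases lt_or_gt_of_ne hxc with hlt | hgt
    · simp [hp x hx.1 hlt, hlt.le]
    · simp [hnp x hgt (lt_of_le_of_ne hx.2 hxb), hgt]
  rw [intervalIntegral.integral_congr_ae hae, intervalIntegral.integral_indicator ⟨hac, hcb⟩]
  simp

theorem integral_ite_lt_eq_min {α y : ℝ} (hα : 0 ≤ α) (hy : 0 ≤ y) :
    ∫ t in (0 : ℝ)..α, (if t < y then (1 : ℝ) else 0) = min y α := by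
  rw [integral_ite_eq_sub (le_min hy hα) (min_le_right y α)
    (fun t _ ht => ht.trans_le (min_le_left y α))
    fun t ht htα hty => ht.not_ge (le_min hty.le htα.le), sub_zero]

theorem integrable_ite_lt {β : Type*} [MeasurableSpace β] {g : β → ℝ} (hg : Measurable g)
    (μ : Measure (ℝ × β)) [IsFiniteMeasure μ] :
    Integrable (fun p => if p.1 < g p.2 then (1 : ℝ) else 0) μ := by
  have hmeas : Measurable fun p : ℝ × β => if p.1 < g p.2 then (1 : ℝ) else 0 :=
    .ite (measurableSet_lt measurable_fst (hg.comp measurable_snd)) measurable_const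
      measurable_const
  refine .of_bound hmeas.aestronglyMeasurable 1 (.of_forall fun p => ?_)
  split_ifs <;> simp

theorem intervalIntegrable_integral_ite_lt {g : ℝ → ℝ} (hg : Measurable g) {a b : ℝ}
    (hab : a ≤ b) (c d : ℝ) :
    IntervalIntegrable (fun t => ∫ x in a..b, if t < g x then (1 : ℝ) else 0) volume c d := by
  simp only [intervalIntegral.integral_of_le hab]
  exact ⟨(integrable_ite_lt hg _).integral_prod_left, (integrable_ite_lt hg _).integral_prod_left⟩

theorem integral_integral_ite_lt_eq_integral_min {g : ℝ → ℝ} (hg : Measurable g)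
    (hnonneg : ∀ x, 0 ≤ g x) {a b α : ℝ} (hab : a ≤ b) (hα : 0 ≤ α) :
    ∫ t in (0 : ℝ)..α, ∫ x in a..b, (if t < g x then (1 : ℝ) else 0) =
      ∫ x in a..b, min (g x) α := by
  simp only [← integral_ite_lt_eq_min hα (hnonneg _), intervalIntegral.integral_of_le hab,
    intervalIntegral.integral_of_le hα]
  exact integral_integral_swap (integrable_ite_lt hg _)

/-! ### Sublinear functionals -/

section Sublinear

theorem sum_apply_single {ι E M : Type*} [Fintype ι] [DecidableEq ι] [Zero E] [AddCommMonoid M]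
    {ρ : ι → E → M} (hρ : ∀ i, ρ i 0 = 0) (i : ι) (x : E) :
    ∑ j, ρ j ((Pi.single i x : ι → E) j) = ρ i x := by
  rw [Fintype.sum_eq_single i fun j hj => by rw [Pi.single_eq_of_ne hj, hρ], Pi.single_eq_same]

variable {E F : Type*} [AddCommGroup E] [Module ℝ E] [AddCommGroup F] [Module ℝ F]

/-- Sublinear functionals: the gauges to which the Hahn–Banach theorem applies. Only positive
scalars occur in the homogeneity, because the value at `0` is then forced to be `0`. -/
structure IsSublinear (p : E → ℝ) : Prop where
  map_add_le : ∀ x y, p (x + y) ≤ p x + p y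
  map_smul : ∀ c : ℝ, 0 < c → ∀ x, p (c • x) = c * p x

namespace IsSublinear

variable {p : E → ℝ}

theorem of_map_smul_le (hadd : ∀ x y, p (x + y) ≤ p x + p y)
    (hsmul : ∀ c : ℝ, 0 < c → ∀ x, p (c • x) ≤ c * p x) : IsSublinear p where
  map_add_le := hadd
  map_smul c hc x := by
    refine le_antisymm (hsmul c hc x) ?_
    have hinv := hsmul c⁻¹ (inv_pos.2 hc) (c • x)
    rwa [inv_smul_smul₀ hc.ne', ← div_eq_inv_mul, le_div_iff₀' hc] at hinv

theorem map_zero (hp : IsSublinear p) : p 0 = 0 := by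
  have htwo := hp.map_smul 2 two_pos 0
  rw [smul_zero] at htwo
  linarith

theorem mul_le_map_smul (hp : IsSublinear p) (c : ℝ) (x : E) : c * p x ≤ p (c • x) := by
  rcases lt_trichotomy c 0 with hc | rfl | hc
  · have hcancel := hp.map_add_le (c • x) ((-c) • x)
    rw [← add_smul, add_neg_cancel, zero_smul, hp.map_zero, hp.map_smul (-c) (neg_pos.2 hc)]
      at hcancel
    linarith
  · simp [hp.map_zero]
  · exact (hp.map_smul c hc x).ge

theorem exists_linearMap_le_eq (hp : IsSublinear p) (x₀ : E) :
    ∃ l : E →ₗ[ℝ] ℝ, (∀ x, l x ≤ p x) ∧ l x₀ = p x₀ := by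
  have hx₀ (c : ℝ) (hc : c • x₀ = 0) : c • p x₀ = 0 := by
    rcases smul_eq_zero.1 hc with rfl | rfl
    · exact zero_smul ℝ _
    · rw [hp.map_zero, smul_zero]
  let f : E →ₗ.[ℝ] ℝ := LinearPMap.mkSpanSingleton' x₀ (p x₀) hx₀
  have hf : ∀ x : f.domain, f x ≤ p x := by
    rintro ⟨x, hx⟩
    obtain ⟨c, rfl⟩ := Submodule.mem_span_singleton.1 hx
    exact (LinearPMap.mkSpanSingleton'_apply x₀ _ hx₀ c hx).trans_le (hp.mul_le_map_smul c x₀)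
  obtain ⟨l, hlf, hlp⟩ := exists_extension_of_le_sublinear f p hp.map_smul hp.map_add_le hf
  have hmem : x₀ ∈ f.domain := Submodule.mem_span_singleton_self x₀
  exact ⟨l, hlp, (hlf ⟨x₀, hmem⟩).trans (LinearPMap.mkSpanSingleton'_apply_self x₀ _ hx₀ hmem)⟩

end IsSublinear

/-- The image of a functional `P` under a linear map `T`, which sends `x` to the infimum of `P`
over the fibre of `T` above `x`. Inf-convolution is the case where `T` sums the coordinates. The
value is meaningful only where `P` is bounded below on a nonempty fibre. -/
noncomputable def infimalImage (T : F →ₗ[ℝ] E) (P : F → ℝ) (x : E) : ℝ :=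
  sInf (P '' (T ⁻¹' {x}))

variable {T : F →ₗ[ℝ] E} {P : F → ℝ}

theorem infimalImage_le (hbdd : ∀ x, BddBelow (P '' (T ⁻¹' {x}))) (y : F) :
    infimalImage T P (T y) ≤ P y :=
  csInf_le (hbdd _) ⟨y, rfl, rfl⟩

theorem le_infimalImage (hT : Function.Surjective T) {x : E} {m : ℝ}
    (hm : ∀ y, T y = x → m ≤ P y) : m ≤ infimalImage T P x := by
  obtain ⟨y, hy⟩ := hT x
  refine le_csInf ⟨P y, y, hy, rfl⟩ ?_
  rintro _ ⟨z, hz, rfl⟩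
  exact hm z hz

theorem IsSublinear.bddBelow_image_fiber (hP : IsSublinear P) (hT : Function.Surjective T)
    {x₀ : E} {m : ℝ} (hm : ∀ y, T y = x₀ → m ≤ P y) (x : E) : BddBelow (P '' (T ⁻¹' {x})) := by
  obtain ⟨z, hz⟩ := hT (x₀ - x)
  refine ⟨m - P z, ?_⟩
  rintro _ ⟨y, rfl, rfl⟩
  have hyz := hm (y + z) (by rw [map_add, hz, add_sub_cancel])
  linarith [hP.map_add_le y z]

theorem IsSublinear.infimalImage (hP : IsSublinear P) (hT : Function.Surjective T)
    (hbdd : ∀ x, BddBelow (P '' (T ⁻¹' {x}))) : IsSublinear (infimalImage T P) := by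
  refine .of_map_smul_le (fun x y => ?_) fun c hc x => ?_
  · rw [← sub_le_iff_le_add]
    refine le_infimalImage hT fun u hu => ?_
    rw [sub_le_comm]
    refine le_infimalImage hT fun v hv => ?_
    rw [sub_le_iff_le_add', ← hu, ← hv, ← map_add]
    exact (infimalImage_le hbdd (u + v)).trans (hP.map_add_le u v)
  · rw [← div_le_iff₀' hc]
    refine le_infimalImage hT fun u hu => ?_
    rw [div_le_iff₀' hc, ← hP.map_smul c hc, ← hu, ← T.map_smul]
    exact infimalImage_le hbdd (c • u)

theorem IsSublinear.exists_linearMap_comp_le (hP : IsSublinear P) (hT : Function.Surjective T)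
    {x₀ : E} {m : ℝ} (hm : ∀ y, T y = x₀ → m ≤ P y) :
    ∃ l : E →ₗ[ℝ] ℝ, (∀ y, l (T y) ≤ P y) ∧ m ≤ l x₀ := by
  have hbdd := hP.bddBelow_image_fiber hT hm
  obtain ⟨l, hl, hlx₀⟩ := (hP.infimalImage hT hbdd).exists_linearMap_le_eq x₀
  exact ⟨l, fun y => (hl _).trans (infimalImage_le hbdd y), (le_infimalImage hT hm).trans hlx₀.ge⟩

theorem IsSublinear.sum_apply {ι : Type*} [Fintype ι] {ρ : ι → E → ℝ}
    (hρ : ∀ i, IsSublinear (ρ i)) : IsSublinear fun y : ι → E => ∑ i, ρ i (y i) where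
  map_add_le x y := by
    rw [← Finset.sum_add_distrib]
    exact Finset.sum_le_sum fun i _ => (hρ i).map_add_le (x i) (y i)
  map_smul c hc y := by
    rw [Finset.mul_sum]
    exact Finset.sum_congr rfl fun i _ => (hρ i).map_smul c hc (y i)

theorem exists_linearMap_le_of_le_sum {ι : Type*} [Fintype ι] [Nonempty ι] {ρ : ι → E → ℝ}
    (hρ : ∀ i, IsSublinear (ρ i)) {x₀ : E} {m : ℝ}
    (hm : ∀ y : ι → E, ∑ i, y i = x₀ → m ≤ ∑ i, ρ i (y i)) :
    ∃ l : E →ₗ[ℝ] ℝ, (∀ i x, l x ≤ ρ i x) ∧ m ≤ l x₀ := by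
  classical
  let T : (ι → E) →ₗ[ℝ] E := ∑ i, LinearMap.proj i
  have hT (y : ι → E) : T y = ∑ i, y i := by simp [T]
  have hsingle (i : ι) (x : E) : T (Pi.single i x) = x := by rw [hT, Fintype.sum_pi_single']
  have hsurj : Function.Surjective T := fun x => ⟨_, hsingle (Classical.arbitrary ι) x⟩
  obtain ⟨l, hl, hlx₀⟩ := (IsSublinear.sum_apply hρ).exists_linearMap_comp_le hsurj
    fun y hy => hm y ((hT y).symm.trans hy)
  refine ⟨l, fun i x => ?_, hlx₀⟩
  simpa only [hsingle, sum_apply_single fun i => (hρ i).map_zero] using hl (Pi.single i x)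

end Sublinear

variable {Ω : Type*} [MeasurableSpace Ω]

/-! ### Capacities and bounded random variables -/

namespace Capacity

theorem monotone (w : Capacity Ω) : Monotone w.toFun := fun A B => w.increasing A B

theorem map_bot (w : Capacity Ω) : w ⊥ = 0 := w.empty

theorem map_top (w : Capacity Ω) : w ⊤ = 1 := w.whole

theorem nonneg (w : Capacity Ω) (A : MSet Ω) : 0 ≤ w A :=
  w.map_bot.symm.trans_le (w.monotone bot_le)

theorem le_one (w : Capacity Ω) (A : MSet Ω) : w A ≤ 1 :=
  (w.monotone le_top).trans_eq w.map_top

end Capacity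

/-- The indicator function of an event, as a bounded random variable. -/
noncomputable def indicatorRV (A : MSet Ω) : BddRV Ω :=
  ⟨(A : Set Ω).indicator 1, measurable_one.indicator A.2, 1, fun ω => by
    by_cases hω : ω ∈ (A : Set Ω) <;> simp [hω]⟩

/-- The constant bounded random variable with value `c`. -/
def constRV (c : ℝ) : BddRV Ω := ⟨fun _ => c, measurable_const, |c|, fun _ => le_rfl⟩

@[simp]
theorem constRV_apply (c : ℝ) (ω : Ω) : (constRV c : BddRV Ω).1 ω = c := rfl

theorem indicatorRV_of_mem {A : MSet Ω} {ω : Ω} (hω : ω ∈ (A : Set Ω)) :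
    (indicatorRV A).1 ω = 1 :=
  indicator_of_mem hω 1

theorem indicatorRV_of_notMem {A : MSet Ω} {ω : Ω} (hω : ω ∉ (A : Set Ω)) :
    (indicatorRV A).1 ω = 0 :=
  indicator_of_notMem hω 1

theorem indicatorRV_nonneg (A : MSet Ω) : 0 ≤ indicatorRV A := fun ω =>
  indicator_nonneg (fun _ _ => zero_le_one) ω

theorem indicatorRV_le_constRV_one (A : MSet Ω) : indicatorRV A ≤ constRV 1 := fun ω =>
  indicator_le_self' (fun _ _ => zero_le_one) ω

theorem indicatorRV_mono : Monotone (indicatorRV : MSet Ω → BddRV Ω) := fun _ _ hAB ω =>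
  indicator_le_indicator_of_subset hAB (fun _ => zero_le_one) ω

theorem indicatorRV_bot : (indicatorRV ⊥ : BddRV Ω) = 0 := Subtype.ext (indicator_empty _)

theorem indicatorRV_top : (indicatorRV ⊤ : BddRV Ω) = constRV 1 := Subtype.ext (indicator_univ _)

theorem indicatorRV_sup_add_inf (A B : MSet Ω) :
    indicatorRV (A ⊔ B) + indicatorRV (A ⊓ B) = indicatorRV A + indicatorRV B :=
  Subtype.ext (indicator_union_add_inter (1 : Ω → ℝ) (A : Set Ω) (B : Set Ω))

theorem constRV_mono : Monotone (constRV : ℝ → BddRV Ω) := fun _ _ hcd _ => hcd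

theorem eventually_constRV_neg_le_le (X : BddRV Ω) :
    ∀ᶠ C in Filter.atTop, constRV (-C) ≤ X ∧ X ≤ constRV C := by
  obtain ⟨B, hB⟩ := X.2.2
  filter_upwards [Filter.eventually_ge_atTop B] with C hBC
  exact ⟨fun ω => (abs_le.1 ((hB ω).trans hBC)).1, fun ω => (abs_le.1 ((hB ω).trans hBC)).2⟩

theorem eventGE_antitone (X : BddRV Ω) : Antitone (eventGE X) := fun _ _ hxy _ hω => hxy.trans hω

theorem eventGE_mono {X Y : BddRV Ω} (hXY : X ≤ Y) (x : ℝ) : eventGE X x ≤ eventGE Y x :=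
  fun ω hω => le_trans hω (hXY ω)

theorem eventGE_eq_top {X : BddRV Ω} {a x : ℝ} (ha : constRV a ≤ X) (hx : x ≤ a) :
    eventGE X x = ⊤ :=
  top_unique fun ω _ => hx.trans (ha ω)

theorem eventGE_eq_bot {X : BddRV Ω} {b x : ℝ} (hb : X ≤ constRV b) (hx : b < x) :
    eventGE X x = ⊥ :=
  bot_unique fun ω hω => (hx.trans_le (le_trans hω (hb ω))).false

theorem eventGE_add_constRV (X : BddRV Ω) (c x : ℝ) :
    eventGE (X + constRV c) x = eventGE X (x - c) :=
  Subtype.ext (by ext ω; simp [eventGE])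

theorem eventGE_smul (X : BddRV Ω) {c : ℝ} (hc : 0 < c) (x : ℝ) :
    eventGE (c • X) x = eventGE X (x / c) :=
  Subtype.ext (by ext ω; simp [eventGE, div_le_iff₀' hc])

theorem eventGE_indicatorRV (A : MSet Ω) {x : ℝ} (hx : x ∈ Ioc (0 : ℝ) 1) :
    eventGE (indicatorRV A) x = A := Subtype.ext <| by
  ext ω
  by_cases hω : ω ∈ (A : Set Ω)
  · simp [eventGE, indicatorRV_of_mem hω, hω, hx.2]
  · simp [eventGE, indicatorRV_of_notMem hω, hω, hx.1]

theorem eventGE_add_smul_indicatorRV (X : BddRV Ω) (A : MSet Ω) {h : ℝ} (hh : 0 ≤ h) (x : ℝ) :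
    eventGE (X + h • indicatorRV A) x = eventGE X x ⊔ A ⊓ eventGE X (x - h) :=
  Subtype.ext <| by
    ext ω
    change x ≤ X.1 ω + h * (indicatorRV A).1 ω ↔ x ≤ X.1 ω ∨ ω ∈ (A : Set Ω) ∧ x - h ≤ X.1 ω
    by_cases hω : ω ∈ (A : Set Ω)
    · simp only [indicatorRV_of_mem hω, hω, true_and, mul_one, tsub_le_iff_right]
      exact ⟨Or.inr, Or.rec (fun hx => hx.trans (le_add_of_nonneg_right hh)) id⟩
    · simp [indicatorRV_of_notMem hω, hω]

theorem Capacity.antitone_eventGE (w : Capacity Ω) (X : BddRV Ω) :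
    Antitone fun x => w (eventGE X x) :=
  w.monotone.comp_antitone (eventGE_antitone X)

theorem Capacity.intervalIntegrable_eventGE (w : Capacity Ω) (X : BddRV Ω) (a b : ℝ) :
    IntervalIntegrable (fun x => w (eventGE X x)) volume a b :=
  (w.antitone_eventGE X).intervalIntegrable

/-! ### The Choquet integral -/

theorem choquet_eq_add_integral (w : Capacity Ω) {X : BddRV Ω} {a b : ℝ} (ha : constRV a ≤ X)
    (hb : X ≤ constRV b) : choquet w X = a + ∫ x in a..b, w (eventGE X x) := by
  have hbelow (x : ℝ) (hx : x ≤ a) : w (eventGE X x) - 1 = 0 := by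
    rw [eventGE_eq_top ha hx, w.map_top, sub_self]
  have habove (x : ℝ) (hx : b < x) : w (eventGE X x) = 0 := by
    rw [eventGE_eq_bot hb hx, w.map_bot]
  have hint := w.intervalIntegrable_eventGE X
  rw [choquet, setIntegral_Iic_eq_intervalIntegral hbelow,
    setIntegral_Ioi_eq_intervalIntegral habove,
    intervalIntegral.integral_sub (hint a 0) intervalIntegrable_const,
    ← intervalIntegral.integral_add_adjacent_intervals (hint a 0) (hint 0 b)]
  simp only [intervalIntegral.integral_const, smul_eq_mul]
  ring

theorem choquet_le_choquet_of_eventGE_le {u v : Capacity Ω} {X Y : BddRV Ω}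
    (h : ∀ x, u (eventGE X x) ≤ v (eventGE Y x)) : choquet u X ≤ choquet v Y := by
  obtain ⟨C, ⟨⟨hCX, hXC⟩, hCY, hYC⟩, hC⟩ := ((eventually_constRV_neg_le_le X).and
    (eventually_constRV_neg_le_le Y)).and (Filter.eventually_ge_atTop 0) |>.exists
  rw [choquet_eq_add_integral u hCX hXC, choquet_eq_add_integral v hCY hYC]
  gcongr
  exact intervalIntegral.integral_mono_on (neg_le_self hC) (u.intervalIntegrable_eventGE X _ _)
    (v.intervalIntegrable_eventGE Y _ _) fun x _ => h x

theorem choquet_mono (w : Capacity Ω) : Monotone (choquet w) := fun _ _ hXY =>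
  choquet_le_choquet_of_eventGE_le fun x => w.monotone (eventGE_mono hXY x)

theorem choquet_mono_capacity {u v : Capacity Ω} (huv : ∀ A, u A ≤ v A) (X : BddRV Ω) :
    choquet u X ≤ choquet v X :=
  choquet_le_choquet_of_eventGE_le fun x => huv (eventGE X x)

theorem choquet_constRV (w : Capacity Ω) (c : ℝ) : choquet w (constRV c) = c := by
  rw [choquet_eq_add_integral w le_rfl le_rfl, intervalIntegral.integral_same, add_zero]

theorem choquet_zero (w : Capacity Ω) : choquet w (0 : BddRV Ω) = 0 := choquet_constRV w 0

theorem Capacity.le_of_constRV_le (w : Capacity Ω) {a b : ℝ}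
    (hab : (constRV a : BddRV Ω) ≤ constRV b) : a ≤ b := by
  simpa only [choquet_constRV] using choquet_mono w hab

theorem choquet_add_constRV (w : Capacity Ω) (X : BddRV Ω) (c : ℝ) :
    choquet w (X + constRV c) = choquet w X + c := by
  obtain ⟨C, hCX, hXC⟩ := (eventually_constRV_neg_le_le X).exists
  rw [choquet_eq_add_integral w hCX hXC,
    choquet_eq_add_integral w (X := X + constRV c) (a := -C + c) (b := C + c)
      (fun ω => add_le_add (hCX ω) le_rfl) (fun ω => add_le_add (hXC ω) le_rfl)]
  simp only [eventGE_add_constRV,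
    intervalIntegral.integral_comp_sub_right (fun x => w (eventGE X x)), add_sub_cancel_right]
  ring

theorem choquet_smul (w : Capacity Ω) {c : ℝ} (hc : 0 < c) (X : BddRV Ω) :
    choquet w (c • X) = c * choquet w X := by
  obtain ⟨C, hCX, hXC⟩ := (eventually_constRV_neg_le_le X).exists
  rw [choquet_eq_add_integral w hCX hXC,
    choquet_eq_add_integral w (X := c • X) (a := c * -C) (b := c * C)
      (fun ω => mul_le_mul_of_nonneg_left (hCX ω) hc.le)
      (fun ω => mul_le_mul_of_nonneg_left (hXC ω) hc.le)]
  simp only [eventGE_smul X hc]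
  rw [intervalIntegral.integral_comp_div (fun x => w (eventGE X x)) hc.ne',
    mul_div_cancel_left₀ _ hc.ne', mul_div_cancel_left₀ _ hc.ne', smul_eq_mul]
  ring

theorem choquet_indicatorRV (w : Capacity Ω) (A : MSet Ω) : choquet w (indicatorRV A) = w A := by
  rw [choquet_eq_add_integral w (a := 0) (indicatorRV_nonneg A) (indicatorRV_le_constRV_one A),
    intervalIntegral.integral_of_le zero_le_one,
    setIntegral_congr_fun measurableSet_Ioc fun x hx => by rw [eventGE_indicatorRV A hx]]
  simp

theorem Capacity.IsSubmodular.apply_eventGE_add_smul_indicatorRV_add_le {w : Capacity Ω}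
    (hw : w.IsSubmodular) (X : BddRV Ω) (A : MSet Ω) {h : ℝ} (hh : 0 ≤ h) (x : ℝ) :
    w (eventGE (X + h • indicatorRV A) x) + w (A ⊓ eventGE X x) ≤
      w (eventGE X x) + w (A ⊓ eventGE X (x - h)) := by
  have hinf : eventGE X x ⊓ (A ⊓ eventGE X (x - h)) = A ⊓ eventGE X x := by
    rw [inf_left_comm, inf_eq_left.2 (eventGE_antitone X (sub_le_self x hh))]
  rw [eventGE_add_smul_indicatorRV X A hh, ← hinf]
  exact hw _ _

theorem choquet_add_smul_indicatorRV_le {w : Capacity Ω} (hw : w.IsSubmodular) (X : BddRV Ω)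
    (A : MSet Ω) {h : ℝ} (hh : 0 ≤ h) :
    choquet w (X + h • indicatorRV A) ≤ choquet w X + h * w A := by
  obtain ⟨C, hCX, hXC⟩ := (eventually_constRV_neg_le_le X).exists
  have hlower : constRV (-C) ≤ X + h • indicatorRV A :=
    hCX.trans fun ω => le_add_of_nonneg_right (mul_nonneg hh (indicatorRV_nonneg A ω))
  have hupper : X + h • indicatorRV A ≤ constRV (C + h) := fun ω =>
    add_le_add (hXC ω) (mul_le_of_le_one_right hh (indicatorRV_le_constRV_one A ω))
  have hle : -C ≤ C + h := w.le_of_constRV_le (hlower.trans hupper)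
  let g : ℝ → ℝ := fun x => w (A ⊓ eventGE X x)
  have hg : Antitone g := fun x y hxy =>
    w.monotone (inf_le_inf_left A (eventGE_antitone X hxy))
  have hg_int : IntervalIntegrable g volume (-C) (C + h) := hg.intervalIntegrable
  have hg_shift_int : IntervalIntegrable (fun x => g (x - h)) volume (-C) (C + h) :=
    (hg.comp_monotone fun x y hxy => sub_le_sub_right hxy h).intervalIntegrable
  have hsubmod := intervalIntegral.integral_mono_on hle
    ((w.intervalIntegrable_eventGE (X + h • indicatorRV A) _ _).add hg_int)
    ((w.intervalIntegrable_eventGE X _ _).add hg_shift_int)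
    fun x _ => hw.apply_eventGE_add_smul_indicatorRV_add_le X A hh x
  rw [intervalIntegral.integral_add (w.intervalIntegrable_eventGE _ _ _) hg_int,
    intervalIntegral.integral_add (w.intervalIntegrable_eventGE _ _ _) hg_shift_int] at hsubmod
  have hshift := integral_comp_sub_right_le_integral_add hg (fun _ => w.nonneg _)
    (fun _ => w.monotone inf_le_left) hh (-C) (C + h)
  rw [choquet_eq_add_integral w hlower hupper,
    choquet_eq_add_integral w hCX (hXC.trans (constRV_mono (le_add_of_nonneg_right hh)))]
  linarith

/-! ### Approximation by staircases -/

/-- The staircase `h ∑_{k=1}^N 1_{Y ≥ a + k h}`, which approximates `Y - a` to within `h` where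
`a ≤ Y ≤ a + (N + 1) h`. -/
noncomputable def staircase (Y : BddRV Ω) (a h : ℝ) (N : ℕ) : BddRV Ω :=
  ∑ k ∈ Finset.range N, h • indicatorRV (eventGE Y (a + h * (k + 1 : ℕ)))

theorem staircase_succ (Y : BddRV Ω) (a h : ℝ) (N : ℕ) :
    staircase Y a h (N + 1) =
      staircase Y a h N + h • indicatorRV (eventGE Y (a + h * (N + 1 : ℕ))) :=
  Finset.sum_range_succ _ _

-- The truncation of `Y` at the top of the staircase lets the bound pass from `N` to `N + 1`.
theorem min_le_add_staircase (Y : BddRV Ω) (a h : ℝ) (N : ℕ) (ω : Ω) :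
    min (Y.1 ω) (a + h * (N + 1 : ℕ)) ≤ a + h + (staircase Y a h N).1 ω := by
  induction N with
  | zero => simp [staircase]
  | succ N ih =>
    have hsucc : (staircase Y a h (N + 1)).1 ω = (staircase Y a h N).1 ω
        + h * (indicatorRV (eventGE Y (a + h * (N + 1 : ℕ)))).1 ω := by
      rw [staircase_succ]; rfl
    rw [hsucc]
    by_cases hω : a + h * (N + 1 : ℕ) ≤ Y.1 ω
    · rw [indicatorRV_of_mem (A := eventGE Y _) hω]
      rw [min_eq_right hω] at ih
      refine (min_le_right _ _).trans ?_
      push_cast at ih ⊢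
      linarith
    · rw [indicatorRV_of_notMem (A := eventGE Y _) hω]
      rw [min_eq_left (not_le.1 hω).le] at ih
      exact (min_le_left _ _).trans (by linarith)

theorem le_constRV_add_staircase {Y : BddRV Ω} {a h : ℝ} {N : ℕ}
    (hY : Y ≤ constRV (a + h * (N + 1 : ℕ))) : Y ≤ constRV (a + h) + staircase Y a h N :=
  fun ω => (min_eq_left (hY ω)).symm.trans_le (min_le_add_staircase Y a h N ω)

theorem map_add_staircase_le {w : Capacity Ω} {φ : BddRV Ω → ℝ}
    (hind : ∀ X A (h : ℝ), 0 ≤ h → φ (X + h • indicatorRV A) ≤ φ X + h * w A)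
    (X Y : BddRV Ω) (a : ℝ) {h : ℝ} (hh : 0 ≤ h) (N : ℕ) :
    φ (X + staircase Y a h N) ≤ φ X + ∫ x in a..a + h * N, w (eventGE Y x) := by
  have hsum : φ (X + staircase Y a h N) ≤
      φ X + ∑ k ∈ Finset.range N, h * w (eventGE Y (a + h * (k + 1 : ℕ))) := by
    induction N with
    | zero => simp [staircase]
    | succ N ih =>
      rw [staircase_succ, Finset.sum_range_succ, ← add_assoc, ← add_assoc]
      exact (hind _ _ _ hh).trans (add_le_add_left ih _)
  exact hsum.trans
    (add_le_add_right (sum_mul_le_integral_of_antitone (w.antitone_eventGE Y) a hh N) _)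

theorem map_add_le_add_choquet {w : Capacity Ω} {φ : BddRV Ω → ℝ} (hmono : Monotone φ)
    (hconst : ∀ X c, φ (X + constRV c) ≤ φ X + c)
    (hind : ∀ X A (h : ℝ), 0 ≤ h → φ (X + h • indicatorRV A) ≤ φ X + h * w A)
    (X Y : BddRV Ω) : φ (X + Y) ≤ φ X + choquet w Y := by
  obtain ⟨C, hCY, hYC⟩ := (eventually_constRV_neg_le_le Y).exists
  refine le_of_forall_pos_le_add fun ε hε => ?_
  obtain ⟨N, hN⟩ := exists_nat_gt ((C - -C) / ε)
  have hCN : C ≤ -C + ε * N := by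
    rw [div_lt_iff₀' hε] at hN
    linarith
  have hYN : Y ≤ constRV (-C + ε * N) := hYC.trans (constRV_mono hCN)
  have hYstair : Y ≤ constRV (-C + ε) + staircase Y (-C) ε N :=
    le_constRV_add_staircase (hYN.trans (constRV_mono (by push_cast; linarith)))
  calc φ (X + Y)
      ≤ φ (X + constRV (-C + ε) + staircase Y (-C) ε N) := by
        rw [add_assoc]
        exact hmono (add_le_add_right hYstair X)
    _ ≤ φ (X + constRV (-C + ε)) + ∫ x in -C..-C + ε * N, w (eventGE Y x) :=
        map_add_staircase_le hind _ Y (-C) hε.le N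
    _ ≤ φ X + (-C + ε) + ∫ x in -C..-C + ε * N, w (eventGE Y x) :=
        add_le_add_left (hconst X _) _
    _ = φ X + choquet w Y + ε := by
        rw [choquet_eq_add_integral w hCY hYN]
        ring

theorem choquet_add_le {w : Capacity Ω} (hw : w.IsSubmodular) (X Y : BddRV Ω) :
    choquet w (X + Y) ≤ choquet w X + choquet w Y :=
  map_add_le_add_choquet (choquet_mono w) (fun X c => (choquet_add_constRV w X c).le)
    (fun X A _ hh => choquet_add_smul_indicatorRV_le hw X A hh) X Y

theorem isSublinear_choquet {w : Capacity Ω} (hw : w.IsSubmodular) : IsSublinear (choquet w) where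
  map_add_le := choquet_add_le hw
  map_smul _ hc := choquet_smul w hc

/-! ### Expected Shortfall as a Choquet integral -/

theorem VaR_eq_sInf (w : Capacity Ω) (t : ℝ) (X : BddRV Ω) :
    VaR w t X = sInf {x | w (eventGE X x) ≤ t} := by
  simp only [VaR, leftQuantile, sub_sub_cancel]

theorem VaR_eq_add_integral (w : Capacity Ω) {X : BddRV Ω} {a b t : ℝ} (ha : constRV a ≤ X)
    (hb : X ≤ constRV b) (ht : t ∈ Ico (0 : ℝ) 1) :
    VaR w t X = a + ∫ x in a..b, if t < w (eventGE X x) then (1 : ℝ) else 0 := by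
  rw [VaR_eq_sInf]
  set S := {x | w (eventGE X x) ≤ t}
  have hlower : a ∈ lowerBounds S := fun x (hx : w (eventGE X x) ≤ t) => by
    by_contra! hxa
    rw [eventGE_eq_top ha hxa.le, w.map_top] at hx
    exact ht.2.not_ge hx
  have hupper (x : ℝ) (hx : b < x) : x ∈ S := by
    change w (eventGE X x) ≤ t
    rw [eventGE_eq_bot hb hx, w.map_bot]
    exact ht.1
  have hne : S.Nonempty := ⟨b + 1, hupper _ (lt_add_one b)⟩
  rw [integral_ite_eq_sub (le_csInf hne hlower)
    (le_of_forall_gt_imp_ge_of_dense fun x hx => csInf_le ⟨a, hlower⟩ (hupper x hx)),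
    add_sub_cancel]
  · exact fun x _ hx => not_le.1 fun hxS => hx.not_ge (csInf_le ⟨a, hlower⟩ hxS)
  · intro x hx _
    obtain ⟨y, hy, hyx⟩ := exists_lt_of_csInf_lt hne hx
    exact not_lt.2 ((w.antitone_eventGE X hyx.le).trans hy)

theorem integral_VaR (w : Capacity Ω) {X : BddRV Ω} {a b α : ℝ} (ha : constRV a ≤ X)
    (hb : X ≤ constRV b) (hα : α ∈ Icc (0 : ℝ) 1) :
    ∫ t in (0 : ℝ)..α, VaR w t X = α * a + ∫ x in a..b, min (w (eventGE X x)) α := by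
  have hab : a ≤ b := w.le_of_constRV_le (ha.trans hb)
  have hmeas := (w.antitone_eventGE X).measurable
  rw [intervalIntegral.integral_congr_Ioo_of_le hα.1 fun t ht =>
      VaR_eq_add_integral w ha hb ⟨ht.1.le, ht.2.trans_le hα.2⟩,
    intervalIntegral.integral_add intervalIntegrable_const
      (intervalIntegrable_integral_ite_lt hmeas hab 0 α),
    integral_integral_ite_lt_eq_integral_min hmeas (fun _ => w.nonneg _) hab hα.1,
    intervalIntegral.integral_const, sub_zero, smul_eq_mul]

/-- The capacity `min (w / α) 1`, whose Choquet integral is the Expected Shortfall `ES w α`. The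
range of `α` is part of the definition, since the whole space gets the value `1` only for
`α ≤ 1`. -/
noncomputable def Capacity.truncate (w : Capacity Ω) {α : ℝ} (hα : α ∈ Ioc (0 : ℝ) 1) :
    Capacity Ω where
  toFun A := min (w A / α) 1
  increasing _ _ hAB := min_le_min_right _ (div_le_div_of_nonneg_right (w.monotone hAB) hα.1.le)
  empty := by rw [w.empty, zero_div, min_eq_left zero_le_one]
  whole := by rw [w.whole, min_eq_right ((one_le_div hα.1).2 hα.2)]

theorem Capacity.truncate_apply (w : Capacity Ω) {α : ℝ} (hα : α ∈ Ioc (0 : ℝ) 1) (A : MSet Ω) :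
    w.truncate hα A = min (w A / α) 1 := rfl

theorem Capacity.truncate_anti (w : Capacity Ω) {α β : ℝ} (hα : α ∈ Ioc (0 : ℝ) 1)
    (hβ : β ∈ Ioc (0 : ℝ) 1) (hαβ : α ≤ β) (A : MSet Ω) : w.truncate hβ A ≤ w.truncate hα A :=
  min_le_min_right _ (div_le_div_of_nonneg_left (w.nonneg A) hα.1 hαβ)

theorem Capacity.IsSubmodular.truncate {w : Capacity Ω} (hw : w.IsSubmodular) {α : ℝ}
    (hα : α ∈ Ioc (0 : ℝ) 1) : (w.truncate hα).IsSubmodular := by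
  intro A B
  have hsup := (w.truncate hα).le_one (A ⊔ B)
  rcases le_total 1 (w A / α) with hA | hA
  · have hA_one : w.truncate hα A = 1 := min_eq_right hA
    linarith [(w.truncate hα).monotone (inf_le_right : A ⊓ B ≤ B)]
  rcases le_total 1 (w B / α) with hB | hB
  · have hB_one : w.truncate hα B = 1 := min_eq_right hB
    linarith [(w.truncate hα).monotone (inf_le_left : A ⊓ B ≤ A)]
  calc w.truncate hα (A ⊔ B) + w.truncate hα (A ⊓ B)
      ≤ w (A ⊔ B) / α + w (A ⊓ B) / α := add_le_add (min_le_left _ _) (min_le_left _ _)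
    _ ≤ w A / α + w B / α := by
        rw [← add_div, ← add_div]
        exact div_le_div_of_nonneg_right (hw A B) hα.1.le
    _ = w.truncate hα A + w.truncate hα B := by
        rw [w.truncate_apply, w.truncate_apply, min_eq_left hA, min_eq_left hB]

theorem ES_eq_choquet_truncate (w : Capacity Ω) {α : ℝ} (hα : α ∈ Ioc (0 : ℝ) 1) :
    ES w α = choquet (w.truncate hα) := by
  funext X
  obtain ⟨C, hCX, hXC⟩ := (eventually_constRV_neg_le_le X).exists
  have hmin (x : ℝ) : min (w (eventGE X x)) α = α * w.truncate hα (eventGE X x) := by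
    rw [w.truncate_apply, mul_min_of_nonneg _ _ hα.1.le, mul_div_cancel₀ _ hα.1.ne', mul_one]
  rw [ES, integral_VaR w hCX hXC (Ioc_subset_Icc_self hα), choquet_eq_add_integral _ hCX hXC]
  simp only [hmin, intervalIntegral.integral_const_mul]
  rw [← mul_add, one_div, inv_mul_cancel_left₀ hα.1.ne']

/-! ### Linear functionals dominated by a Choquet integral -/

theorem monotone_of_le_choquet {v : Capacity Ω} {l : BddRV Ω →ₗ[ℝ] ℝ}
    (hl : ∀ X, l X ≤ choquet v X) : Monotone l := fun X Y hXY => by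
  have hdiff : choquet v (X - Y) ≤ choquet v 0 :=
    choquet_mono v fun ω => sub_nonpos.2 (hXY ω)
  rw [← sub_nonpos, ← map_sub]
  exact (hl _).trans (hdiff.trans_eq (choquet_zero v))

theorem map_constRV_of_le_choquet {v : Capacity Ω} {l : BddRV Ω →ₗ[ℝ] ℝ}
    (hl : ∀ X, l X ≤ choquet v X) (c : ℝ) : l (constRV c) = c := by
  have hle (d : ℝ) : l (constRV d) ≤ d := (hl _).trans_eq (choquet_constRV v d)
  have hneg : l (constRV (-c)) = -l (constRV c) := l.map_neg (constRV c)
  exact le_antisymm (hle c) (neg_le_neg_iff.1 (hneg.symm.trans_le (hle (-c))))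

/-- The additive capacity `A ↦ l 1_A` that a normalized increasing linear functional induces. -/
noncomputable def Capacity.ofLinearMap (l : BddRV Ω →ₗ[ℝ] ℝ) (hmono : Monotone l)
    (hone : l (constRV 1) = 1) : Capacity Ω where
  toFun A := l (indicatorRV A)
  increasing _ _ hAB := hmono (indicatorRV_mono hAB)
  empty := (congrArg l indicatorRV_bot).trans l.map_zero
  whole := (congrArg l indicatorRV_top).trans hone

theorem Capacity.isSubmodular_ofLinearMap {l : BddRV Ω →ₗ[ℝ] ℝ} (hmono : Monotone l)
    (hone : l (constRV 1) = 1) : (ofLinearMap l hmono hone).IsSubmodular := fun A B => by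
  change l _ + l _ ≤ l _ + l _
  rw [← map_add, ← map_add, indicatorRV_sup_add_inf]

theorem exists_isSubmodular_of_le_choquet {v : Capacity Ω} {l : BddRV Ω →ₗ[ℝ] ℝ}
    (hl : ∀ X, l X ≤ choquet v X) :
    ∃ u : Capacity Ω, u.IsSubmodular ∧ (∀ A, u A = l (indicatorRV A)) ∧
      ∀ X, l X ≤ choquet u X := by
  have hmono := monotone_of_le_choquet hl
  have hconst := map_constRV_of_le_choquet hl
  have hind (X : BddRV Ω) (A : MSet Ω) (h : ℝ) :
      l (X + h • indicatorRV A) = l X + h * l (indicatorRV A) := by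
    rw [map_add, map_smul, smul_eq_mul]
  refine ⟨.ofLinearMap l hmono (hconst 1), Capacity.isSubmodular_ofLinearMap hmono (hconst 1),
    fun _ => rfl, fun X => ?_⟩
  simpa only [zero_add, map_zero] using map_add_le_add_choquet
    (w := .ofLinearMap l hmono (hconst 1)) hmono (fun Y c => by rw [map_add, hconst])
    (fun Y A h _ => (hind Y A h).le) 0 X

/-! ### Inf-convolutions of Choquet integrals -/

theorem infConvolution_le {n : ℕ} {ρ : Fin n → BddRV Ω → ℝ} (hρ : ∀ i, ρ i 0 = 0) (i : Fin n)
    (X : BddRV Ω) : infConvolution ρ X ≤ ρ i X := by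
  have hmem : Pi.single i X ∈ allocations n X := Fintype.sum_pi_single' i X
  have hle : infConvolution ρ X ≤ (∑ j, ρ j ((Pi.single i X : Fin n → BddRV Ω) j) : ℝ) :=
    iInf₂_le _ hmem
  rwa [sum_apply_single hρ] at hle

theorem choquet_le_infConvolution {n : ℕ} {u : Capacity Ω} (hu : u.IsSubmodular)
    {v : Fin n → Capacity Ω} (huv : ∀ i A, u A ≤ v i A) (X : BddRV Ω) :
    choquet u X ≤ infConvolution (fun i => choquet (v i)) X := by
  refine le_iInf₂ fun Y hY => EReal.coe_le_coe_iff.2 ?_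
  calc choquet u X = choquet u (∑ i, Y i) := congrArg _ hY.symm
    _ ≤ ∑ i, choquet u (Y i) :=
        Finset.le_sum_of_subadditive _ (choquet_zero u).le (choquet_add_le hu) _ _
    _ ≤ ∑ i, choquet (v i) (Y i) :=
        Finset.sum_le_sum fun i _ => choquet_mono_capacity (huv i) _

theorem exists_le_choquet_of_lt_infConvolution {n : ℕ} [NeZero n] {v : Fin n → Capacity Ω}
    (hv : ∀ i, (v i).IsSubmodular) {X : BddRV Ω} {m : ℝ}
    (hm : m < infConvolution (fun i => choquet (v i)) X) :
    ∃ u : Capacity Ω, u.IsSubmodular ∧ (∀ i A, u A ≤ v i A) ∧ m ≤ choquet u X := by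
  obtain ⟨l, hl, hlX⟩ := exists_linearMap_le_of_le_sum (fun i => isSublinear_choquet (hv i))
    fun Y (hY : Y ∈ allocations n X) => EReal.coe_le_coe_iff.1 (hm.le.trans (iInf₂_le Y hY))
  obtain ⟨u, hu, hul, hlu⟩ := exists_isSubmodular_of_le_choquet (hl 0)
  refine ⟨u, hu, fun i A => ?_, hlX.trans (hlu X)⟩
  rw [hul, ← choquet_indicatorRV]
  exact hl i _

theorem infConvolution_choquet {n : ℕ} [NeZero n] {v : Fin n → Capacity Ω}
    (hv : ∀ i, (v i).IsSubmodular) (X : BddRV Ω) :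
    infConvolution (fun i => choquet (v i)) X =
      sSup {r : EReal | ∃ u : Capacity Ω, u.IsSubmodular ∧ (∀ i A, u A ≤ v i A) ∧
        r = (choquet u X : EReal)} := by
  apply le_antisymm
  · refine EReal.ge_of_forall_gt_iff_ge.1 fun m hm => ?_
    obtain ⟨u, hu, huv, hmu⟩ := exists_le_choquet_of_lt_infConvolution hv hm
    exact le_sSup_of_le ⟨u, hu, huv, rfl⟩ (EReal.coe_le_coe_iff.2 hmu)
  · refine sSup_le ?_
    rintro _ ⟨u, hu, huv, rfl⟩
    exact choquet_le_infConvolution hu huv X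

theorem infConvolution_choquet_of_le {n : ℕ} {v : Fin n → Capacity Ω} {j : Fin n}
    (hj : (v j).IsSubmodular) (hmin : ∀ i A, v j A ≤ v i A) (X : BddRV Ω) :
    infConvolution (fun i => choquet (v i)) X = choquet (v j) X :=
  le_antisymm (infConvolution_le (fun i => choquet_zero (v i)) j X)
    (choquet_le_infConvolution hj hmin X)

theorem Capacity.le_iInf_div_iff {ι : Type*} [Finite ι] [Nonempty ι] {α : ι → ℝ}
    (hα : ∀ i, α i ∈ Ioc (0 : ℝ) 1) (u : Capacity Ω) (w : ι → Capacity Ω) :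
    (∀ A, u A ≤ ⨅ i, w i A / α i) ↔ ∀ i A, u A ≤ (w i).truncate (hα i) A := by
  simp only [le_ciInf_iff (finite_range _).bddBelow, truncate_apply, le_min_iff, u.le_one,
    and_true]
  exact forall_comm

end ChoquetES

theorem mainTheorem8 {Ω : Type*} [MeasurableSpace Ω] (n : ℕ) (hn : 1 ≤ n)
    (α : Fin n → ℝ) (hα : ∀ i, α i ∈ Set.Ioc (0 : ℝ) 1) :
    (∀ w : Fin n → ChoquetES.Capacity Ω, (∀ i, (w i).IsSubmodular) →
      ∀ X : ChoquetES.BddRV Ω,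
        ChoquetES.infConvolution (fun i => ChoquetES.ES (w i) (α i)) X =
          sSup {r : EReal | ∃ u : ChoquetES.Capacity Ω, u.IsSubmodular ∧
            (∀ A : ChoquetES.MSet Ω, u A ≤ ⨅ i, w i A / α i) ∧
            r = (ChoquetES.choquet u X : EReal)}) ∧
    (∀ w : ChoquetES.Capacity Ω, w.IsSubmodular →
      ∀ X : ChoquetES.BddRV Ω,
        ChoquetES.infConvolution (fun i => ChoquetES.ES w (α i)) X =
          (ChoquetES.ES w (⨆ i, α i) X : EReal)) := by
  have : NeZero n := ⟨Nat.one_le_iff_ne_zero.1 hn⟩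
  refine ⟨fun w hw X => ?_, fun w hw X => ?_⟩
  · simp only [ChoquetES.ES_eq_choquet_truncate _ (hα _), ChoquetES.Capacity.le_iInf_div_iff hα]
    exact ChoquetES.infConvolution_choquet (fun i => (hw i).truncate (hα i)) X
  · obtain ⟨j, hj⟩ := exists_eq_ciSup_of_finite (f := α)
    have hmax (i : Fin n) : α i ≤ α j := hj ▸ le_ciSup (Set.finite_range α).bddAbove i
    simp only [← hj, ChoquetES.ES_eq_choquet_truncate w (hα _)]
    exact ChoquetES.infConvolution_choquet_of_le (hw.truncate (hα j))
      (fun i => w.truncate_anti (hα i) (hα j) (hmax i)) X
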